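/- Let $M$ be an integral domain with field of fractions $k$, let $G$ be a subgroup of its unit group, and suppose that $M$ is a finitely generated $\mathbb{Z}[G]$-algebra via the natural homomorphism $\mathbb{Z}[G]\to M$. Let $X=\widehat{M}$ be the Pontryagin dual of the discrete additive group of $M$, and let $G$ act on $X$ by the automorphisms $\alpha_g$ dual to multiplication by $g\in G$ on $M$. The action is called expansive if there is a neighbourhood $N$ of the identity of $X$ such that $\bigcap_{g\in G}\alpha_g(N)$ consists of the identity alone. Let $M_G$ be the smallest subring of $M$ containing $G$. Let $\mathcal{V}_\infty(M_G)$ be the set of all logarithmic maps $v_\phi:M_G\to\mathbb{R}\cup\{\infty\}$, $v_\phi(a)=\log|\phi(a)|$ (with $v_\phi(a)=\infty$ if $\phi(a)=0$), where $\phi$ runs through the ring homomorphisms $M_G\to\mathbb{C}$. Let $\mathcal{V}_{\mathcal{Z}}(M)$ be the collection of the valuations of $k$ corresponding to those valuation rings of $k$ that contain the prime ring of $k$ ($\mathbb{Z}$ or $\mathbb{F}_p$) but do not contain $M$. Then the action of $G$ on $X$ is expansive if and only if $v|_G$ is non-trivial (that is, $v(g)\neq 0$ for some $g\in G$, in additive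 notation) for every $v\in\mathcal{V}_\infty(M_G)\cup\mathcal{V}_{\mathcal{Z}}(M)$. -/

import Mathlib

open Topology

noncomputable section

namespace AlgebraicAction

/-- A family `α` of automorphisms of a topological group `X` (for instance an action of a group
on `X`) is expansive if there is a neighbourhood `N` of the identity of `X` with
`⋂ g, α_g (N) = {1}`. The group `X` is written multiplicatively. -/
def IsExpansive {ι X : Type*} [Group X] [TopologicalSpace X] (α : ι → X ≃ₜ* X) : Prop :=
  ∃ N ∈ 𝓝 (1 : X), ⋂ g, (α g : X → X) '' N = {1}

section Dual

variable (M : Type*) [CommRing M] [TopologicalSpace M] [DiscreteTopology M]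

/-- The Pontryagin dual of the additive group of the discrete ring `M`. -/
abbrev Dual : Type _ := PontryaginDual (Multiplicative M)

variable {M}

/-- Multiplication by `a`, as a continuous endomorphism of the discrete additive group of `M`. -/
def mulHom (a : M) : Multiplicative M →ₜ* Multiplicative M where
  toMonoidHom := AddMonoidHom.toMultiplicative (AddMonoidHom.mulLeft a)
  continuous_toFun := continuous_of_discreteTopology

/-- The automorphism of the dual of `M` that is dual to multiplication by the unit `u`. -/
def dualAut (u : Mˣ) : Dual M ≃ₜ* Dual M where
  toFun := PontryaginDual.map (mulHom (u : M))
  invFun := PontryaginDual.map (mulHom ((u⁻¹ : Mˣ) : M))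
  left_inv x := PontryaginDual.ext fun m => congrArg x (by
    change Multiplicative.ofAdd ((u : M) * ((u⁻¹ : Mˣ) * m.toAdd)) = m
    simp)
  right_inv x := PontryaginDual.ext fun m => congrArg x (by
    change Multiplicative.ofAdd (((u⁻¹ : Mˣ) : M) * (u * m.toAdd)) = m
    simp)
  map_mul' := map_mul _
  continuous_toFun := (PontryaginDual.map (mulHom (u : M))).continuous_toFun
  continuous_invFun := (PontryaginDual.map (mulHom ((u⁻¹ : Mˣ) : M))).continuous_toFun

theorem dualAut_apply (u : Mˣ) (x : Dual M) (m : M) :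
    dualAut u x (Multiplicative.ofAdd m) = x (Multiplicative.ofAdd (u * m)) := rfl

theorem dualAut_one (x : Dual M) : dualAut (1 : Mˣ) x = x :=
  PontryaginDual.ext fun m => congrArg x (by
    change Multiplicative.ofAdd (((1 : Mˣ) : M) * m.toAdd) = m
    simp)

theorem dualAut_mul (u w : Mˣ) (x : Dual M) : dualAut (u * w) x = dualAut u (dualAut w x) :=
  PontryaginDual.ext fun m => congrArg x (by
    change Multiplicative.ofAdd (((u * w : Mˣ) : M) * m.toAdd) =
      Multiplicative.ofAdd ((w : M) * (u * m.toAdd))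
    congr 1
    push_cast
    ring)

/-- The action of a group `G` of units of `M` on the dual of `M`. -/
def dualAction (G : Subgroup Mˣ) : G → Dual M ≃ₜ* Dual M := fun g => dualAut (g : Mˣ)

end Dual

section Ring

variable {M : Type*} [CommRing M]

/-- The natural homomorphism `ℤ[G] → M`, which makes `M` a `ℤ[G]`-algebra. -/
def groupRingHom (G : Subgroup Mˣ) : MonoidAlgebra ℤ G →+* M :=
  (MonoidAlgebra.lift ℤ M G ((Units.coeHom M).comp G.subtype) : MonoidAlgebra ℤ G →ₐ[ℤ] M)

/-- `M_G`, the smallest subring of `M` containing `G`. -/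
def unitSubring (G : Subgroup Mˣ) : Subring M :=
  Subring.closure ((fun u : Mˣ => (u : M)) '' (G : Set Mˣ))

/-- An element of `G` as an element of `M_G`. -/
def toUnitSubring (G : Subgroup Mˣ) (g : G) : unitSubring G :=
  ⟨((g : Mˣ) : M), Subring.subset_closure ⟨g, g.2, rfl⟩⟩

end Ring

section Logarithmic

variable {R : Type*} [CommRing R]

open Classical in
/-- The logarithmic map `v_φ : R → ℝ ∪ {∞}`, `a ↦ log |φ a|`, attached to a homomorphism
`φ : R → ℂ`; the zeros of `φ` are sent to the extra value `∞`. -/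
def logMap (φ : R →+* ℂ) (a : R) : WithTop ℝ :=
  if φ a = 0 then ⊤ else ((Real.log ‖φ a‖ : ℝ) : WithTop ℝ)

variable (R) in
/-- The collection of all logarithmic maps on `R` arising from homomorphisms `R → ℂ`. -/
def logMaps : Set (R → WithTop ℝ) := Set.range (logMap (R := R))

end Logarithmic

section Zariski

/-- The Zariski space of valuation rings of the field `k` that contain the subring `R`. -/
def Zar (k : Type*) [Field k] (R : Subring k) : Set (ValuationSubring k) :=
  {V | R ≤ V.toSubring}

/-- The valuation rings of `k` that contain the prime ring of `k` (the subring `⊥` generated by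
`1`) but do not contain `M`. -/
def zarDiff (M k : Type*) [CommRing M] [Field k] [Algebra M k] : Set (ValuationSubring k) :=
  Zar k ⊥ \ Zar k (algebraMap M k).range

end Zariski

end AlgebraicAction

end

/-! The valuation condition says that `M` is integral over `ℤ[G]`: the integral closure of a subring
of `k` is the intersection of the valuation rings above it. As `M` is of finite type, this means
that `M` is a finite `ℤ[G]`-module.

Expansiveness forces finiteness, since a character killing the span of the finitely many test
elements never leaves the neighbourhood. It also excludes unitary `φ : M_G → ℂ`: by integrality `φ`
extends to `θ : M → ℂ`, and `m ↦ exp(i t Re θ(m))` has a uniformly small orbit for small `t > 0`.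

Conversely, lifting a point with small orbit to real arguments gives bounded functions on `G`
satisfying the recurrences from finitely many relations of `M_G`. A nonzero one would yield, by
Gelfand theory, a unitary character killing these relations (`exists_character_of_bounded`).
Compactness (`exists_finite_of_no_character`) lets the finite set be chosen so that none exists. -/

namespace AlgebraicAction

/-! ### Unitary characters from Gelfand theory and compactness -/

section Characters

variable {Γ : Type*} [CommGroup Γ]

/-- A contractive homomorphism from a group to a commutative Banach algebra induces a unitary
character that annihilates a given proper ideal. -/
theorem exists_character_of_ideal {A : Type*} [NormedCommRing A] [NormedAlgebra ℂ A]
    [CompleteSpace A] [NormOneClass A] (ρ : Γ →* A) (hρ : ∀ g, ‖ρ g‖ ≤ 1) (J : Ideal A)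
    (hJ : J ≠ ⊤) :
    ∃ χ : Γ →* ℂ, (∀ g, ‖χ g‖ = 1) ∧ ∀ f : MonoidAlgebra ℤ Γ,
      MonoidAlgebra.lift ℤ _ Γ ρ f ∈ J → MonoidAlgebra.lift ℤ _ Γ χ f = 0 := by
  obtain ⟨I, hI, hJI⟩ := Ideal.exists_le_maximal J hJ
  -- By Gelfand–Mazur the residue field at a maximal ideal is `ℂ`.
  let φ : A →ₐ[ℂ] ℂ := WeakDual.CharacterSpace.equivAlgHom I.toCharacterSpace
  have hle : ∀ g, ‖φ (ρ g)‖ ≤ 1 := fun g => (AlgHom.norm_apply_le_self φ (ρ g)).trans (hρ g)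
  refine ⟨(φ : A →* ℂ).comp ρ, fun g => le_antisymm (hle g) ?_, fun f hf => ?_⟩
  · have h1 : φ (ρ g) * φ (ρ g⁻¹) = 1 := by
      rw [← map_mul, ← map_mul, mul_inv_cancel, map_one, map_one]
    have h2 : ‖φ (ρ g)‖ * ‖φ (ρ g⁻¹)‖ = 1 := by rw [← norm_mul, h1, norm_one]
    change 1 ≤ ‖φ (ρ g)‖
    nlinarith [hle g⁻¹, norm_nonneg (φ (ρ g)), norm_nonneg (φ (ρ g⁻¹))]
  · have h3 : φ (MonoidAlgebra.lift ℤ _ Γ ρ f) = 0 :=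
      I.toCharacterSpace_apply_eq_zero_of_mem (hJI hf)
    rw [← h3]
    simp only [MonoidAlgebra.lift_apply, Finsupp.sum, map_sum, map_zsmul]
    rfl

/-- A representation of a commutative group by contractions of a Banach space has, for every
nonzero vector `y`, a unitary character that annihilates the annihilator of `y`. -/
theorem exists_character_of_contractions {E : Type*} [NormedAddCommGroup E] [NormedSpace ℂ E]
    [CompleteSpace E] (ρ : Γ →* (E →L[ℂ] E)) (hρ : ∀ g, ‖ρ g‖ ≤ 1) {y : E} (hy : y ≠ 0) :
    ∃ χ : Γ →* ℂ, (∀ g, ‖χ g‖ = 1) ∧ ∀ f : MonoidAlgebra ℤ Γ,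
      MonoidAlgebra.lift ℤ _ Γ ρ f y = 0 → MonoidAlgebra.lift ℤ _ Γ χ f = 0 := by
  set s : Set (E →L[ℂ] E) := Set.range ρ
  have hcomm : ∀ g h, ρ g * ρ h = ρ h * ρ g := fun g h => by
    rw [← map_mul, ← map_mul, mul_comm]
  -- The bicommutant of a commuting set is commutative and norm closed, hence a commutative Banach
  -- algebra containing the image of `ρ`.
  set A : Subalgebra ℂ (E →L[ℂ] E) :=
    Subalgebra.centralizer ℂ (Subalgebra.centralizer ℂ s : Set (E →L[ℂ] E)) with hA
  have hsC : s ⊆ (Subalgebra.centralizer ℂ s : Set (E →L[ℂ] E)) := by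
    rintro _ ⟨g, rfl⟩
    rw [SetLike.mem_coe, Subalgebra.mem_centralizer_iff]
    rintro _ ⟨h, rfl⟩
    exact hcomm h g
  have hAC : ∀ a ∈ A, a ∈ Subalgebra.centralizer ℂ s := by
    intro a ha
    rw [Subalgebra.mem_centralizer_iff] at ha ⊢
    exact fun b hb => ha b (hsC hb)
  have hρA : ∀ g, ρ g ∈ A := by
    intro g
    rw [hA, Subalgebra.mem_centralizer_iff]
    intro b hb
    exact (Subalgebra.mem_centralizer_iff ℂ |>.mp hb (ρ g) ⟨g, rfl⟩).symm
  let : NormedCommRing A :=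
    { (inferInstance : NormedRing A) with
      mul_comm := fun a b => Subtype.ext
        (Subalgebra.mem_centralizer_iff ℂ |>.mp b.2 a (hAC a a.2)) }
  have hclosed : IsClosed (A : Set (E →L[ℂ] E)) := Set.isClosed_centralizer _
  have : CompleteSpace A := hclosed.completeSpace_coe
  have : Nontrivial E := ⟨y, 0, hy⟩
  have : NormOneClass A := ⟨norm_one (α := E →L[ℂ] E)⟩
  let J : Ideal A :=
    { carrier := {a | (a : E →L[ℂ] E) y = 0}
      add_mem' := fun {a b} (ha : (a : E →L[ℂ] E) y = 0) (hb : (b : E →L[ℂ] E) y = 0) => by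
        change (a : E →L[ℂ] E) y + (b : E →L[ℂ] E) y = 0
        rw [ha, hb, add_zero]
      zero_mem' := rfl
      smul_mem' := fun c a (ha : (a : E →L[ℂ] E) y = 0) => by
        change (c : E →L[ℂ] E) ((a : E →L[ℂ] E) y) = 0
        rw [ha, map_zero] }
  have hJ : J ≠ ⊤ := fun h => hy (((Ideal.eq_top_iff_one J).mp h : (1 : E →L[ℂ] E) y = 0))
  let ρA : Γ →* A :=
    { toFun := fun g => ⟨ρ g, hρA g⟩
      map_one' := Subtype.ext (map_one ρ)
      map_mul' := fun g h => Subtype.ext (map_mul ρ g h) }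
  obtain ⟨χ, hχ, hann⟩ := exists_character_of_ideal ρA hρ J hJ
  refine ⟨χ, hχ, fun f hf => hann f ?_⟩
  have h1 : ((MonoidAlgebra.lift ℤ _ Γ ρA f : A) : E →L[ℂ] E) =
      MonoidAlgebra.lift ℤ _ Γ ρ f := by
    simp only [MonoidAlgebra.lift_apply, Finsupp.sum]
    rw [← Subalgebra.coe_val, map_sum]
    exact Finset.sum_congr rfl fun g _ => map_zsmul A.val _ _
  change ((MonoidAlgebra.lift ℤ _ Γ ρA f : A) : E →L[ℂ] E) y = 0
  rw [h1, hf]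

/-- If a nonzero bounded function on a commutative group satisfies a set of linear recurrences,
then so does some unitary character. -/
theorem exists_character_of_bounded {S : Set (MonoidAlgebra ℤ Γ)} {y : Γ → ℂ} {C : ℝ}
    (hC : ∀ g, ‖y g‖ ≤ C) (hy : y ≠ 0)
    (hS : ∀ f ∈ S, ∀ h, (f.coeff.sum fun g n => n • y (h * g)) = 0) :
    ∃ χ : Γ →* ℂ, (∀ g, ‖χ g‖ = 1) ∧ ∀ f ∈ S, MonoidAlgebra.lift ℤ _ Γ χ f = 0 := by
  let : TopologicalSpace Γ := ⊥
  have : DiscreteTopology Γ := ⟨rfl⟩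
  let T : Γ → BoundedContinuousFunction Γ ℂ →ₗ[ℂ] BoundedContinuousFunction Γ ℂ := fun g =>
    { toFun := fun z => z.compContinuous ⟨fun h => h * g, continuous_of_discreteTopology⟩
      map_add' := fun _ _ => rfl
      map_smul' := fun _ _ => rfl }
  have hT : ∀ g z, ‖T g z‖ ≤ 1 * ‖z‖ := fun g z => by
    rw [one_mul]
    exact (BoundedContinuousFunction.norm_le (norm_nonneg z)).mpr fun h => z.norm_coe_le_norm _
  let ρ : Γ →* BoundedContinuousFunction Γ ℂ →L[ℂ] BoundedContinuousFunction Γ ℂ :=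
    { toFun := fun g => (T g).mkContinuous 1 (hT g)
      map_one' := by
        ext z h
        change z (h * 1) = z h
        rw [mul_one]
      map_mul' := fun a b => by
        ext z h
        change z (h * (a * b)) = z (h * a * b)
        rw [mul_assoc] }
  let Y : BoundedContinuousFunction Γ ℂ :=
    BoundedContinuousFunction.ofNormedAddCommGroupDiscrete y C hC
  have hY : Y ≠ 0 := fun h => hy (funext fun g => congrArg (fun z => z g) h)
  obtain ⟨χ, hχ, hann⟩ := exists_character_of_contractions ρ
    (fun g => LinearMap.mkContinuous_norm_le _ zero_le_one (hT g)) hY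
  refine ⟨χ, hχ, fun f hf => hann f ?_⟩
  ext h
  rw [BoundedContinuousFunction.coe_zero, Pi.zero_apply, ← hS f hf h, MonoidAlgebra.lift_apply,
    Finsupp.sum, Finsupp.sum, sum_apply, BoundedContinuousFunction.sum_apply]
  rfl

/-- A set of elements of the group ring without common unitary zero has a finite subset without
common unitary zero. -/
theorem exists_finite_of_no_character {S : Set (MonoidAlgebra ℤ Γ)}
    (hS : ¬ ∃ χ : Γ →* ℂ, (∀ g, ‖χ g‖ = 1) ∧ ∀ f ∈ S, MonoidAlgebra.lift ℤ _ Γ χ f = 0) :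
    ∃ T : Finset (MonoidAlgebra ℤ Γ), (T : Set (MonoidAlgebra ℤ Γ)) ⊆ S ∧
      ¬ ∃ χ : Γ →* ℂ, (∀ g, ‖χ g‖ = 1) ∧ ∀ f ∈ T, MonoidAlgebra.lift ℤ _ Γ χ f = 0 := by
  classical
  let K : Set (Γ → ℂ) := {χ | (∀ g, ‖χ g‖ = 1) ∧ χ 1 = 1 ∧ ∀ g h, χ (g * h) = χ g * χ h}
  have hKclosed : IsClosed K := by
    have : K = (⋂ g, {χ | ‖χ g‖ = 1}) ∩
        ({χ | χ 1 = 1} ∩ ⋂ g, ⋂ h, {χ | χ (g * h) = χ g * χ h}) := by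
      ext χ
      simp [K]
    rw [this]
    refine (isClosed_iInter fun g => ?_).inter
      (IsClosed.inter ?_ (isClosed_iInter fun g => isClosed_iInter fun h => ?_)) <;>
    exact isClosed_eq (by fun_prop) (by fun_prop)
  have hK : IsCompact K := by
    refine (isCompact_univ_pi fun _ : Γ => isCompact_closedBall (0 : ℂ) 1).of_isClosed_subset
      hKclosed fun χ hχ g _ => ?_
    rw [mem_closedBall_zero_iff]
    exact (hχ.1 g).le
  let Z : S → Set (Γ → ℂ) := fun f => {χ | (f.1.coeff.sum fun g n => n • χ g) = 0}
  have hZ : ∀ f, IsClosed (Z f) := fun f => by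
    refine isClosed_eq ?_ continuous_const
    exact continuous_finsetSum _ fun g _ => by fun_prop
  have toHom : ∀ χ ∈ K, ∃ χ' : Γ →* ℂ, ⇑χ' = χ := fun χ hχ =>
    ⟨{ toFun := χ, map_one' := hχ.2.1, map_mul' := hχ.2.2 }, rfl⟩
  obtain ⟨u, hu⟩ := hK.elim_finite_subfamily_closed Z hZ (by
    rw [Set.eq_empty_iff_forall_notMem]
    rintro χ ⟨hχ, hχZ⟩
    obtain ⟨χ', rfl⟩ := toHom χ hχ
    refine hS ⟨χ', hχ.1, fun f hf => ?_⟩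
    rw [MonoidAlgebra.lift_apply]
    exact Set.mem_iInter.mp hχZ ⟨f, hf⟩)
  refine ⟨u.image Subtype.val, ?_, ?_⟩
  · intro f hf
    obtain ⟨f', -, rfl⟩ := Finset.mem_image.mp hf
    exact f'.2
  · rintro ⟨χ, hχ, hf⟩
    refine Set.eq_empty_iff_forall_notMem.mp hu χ
      ⟨⟨hχ, map_one χ, map_mul χ⟩, Set.mem_iInter₂.mpr fun f hfu => ?_⟩
    have := hf f.1 (Finset.mem_image_of_mem _ hfu)
    rwa [MonoidAlgebra.lift_apply] at this

end Characters

/-! ### Extending homomorphisms along integral maps -/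

section Algebra

/-- A homomorphism to an algebraically closed field extends along an integral homomorphism whose
kernel it annihilates. -/
theorem exists_comp_eq_of_isIntegral {A B L : Type*} [CommRing A] [CommRing B] [Field L]
    [IsAlgClosed L] (f : A →+* B) (hf : f.IsIntegral) (φ : A →+* L)
    (hφ : RingHom.ker f ≤ RingHom.ker φ) : ∃ ψ : B →+* L, ψ.comp f = φ := by
  let := f.toAlgebra
  have : Algebra.IsIntegral A B := ⟨hf⟩
  have : (RingHom.ker φ).IsPrime := RingHom.ker_isPrime φ
  -- Lying over: `B ⧸ Q` is then an integral extension of `A ⧸ ker φ`, which embeds in `L`.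
  obtain ⟨Q, -, hQ, hQP⟩ := Ideal.exists_ideal_over_prime_of_isIntegral (RingHom.ker φ)
    (⊥ : Ideal B) hφ
  let P := RingHom.ker φ
  let : Algebra (A ⧸ P) (B ⧸ Q) := (Ideal.quotientMap Q f hQP.ge).toAlgebra
  let : Algebra (A ⧸ P) L := (RingHom.kerLift φ).toAlgebra
  have : Algebra.IsIntegral (A ⧸ P) (B ⧸ Q) := ⟨by
    intro b
    obtain ⟨b, rfl⟩ := Ideal.Quotient.mk_surjective b
    obtain ⟨p, hp, hpb⟩ := hf b
    refine ⟨p.map (Ideal.Quotient.mk P), hp.map _, ?_⟩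
    rw [Polynomial.eval₂_map]
    have : (algebraMap (A ⧸ P) (B ⧸ Q)).comp (Ideal.Quotient.mk P) =
      (Ideal.Quotient.mk Q).comp f := rfl
    rw [this, ← Polynomial.hom_eval₂, hpb, map_zero]⟩
  have hinj : Function.Injective (algebraMap (A ⧸ P) (B ⧸ Q)) :=
    Ideal.quotientMap_injective' hQP.le
  have : Module.IsTorsionFree (A ⧸ P) (B ⧸ Q) := 
    Module.isTorsionFree_iff_algebraMap_injective.mpr hinj
  have : Module.IsTorsionFree (A ⧸ P) L :=
    Module.isTorsionFree_iff_algebraMap_injective.mpr (RingHom.kerLift_injective φ)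
  let θ : (B ⧸ Q) →ₐ[A ⧸ P] L := IsAlgClosed.lift
  refine ⟨(θ : (B ⧸ Q) →+* L).comp (Ideal.Quotient.mk Q), RingHom.ext fun a => ?_⟩
  exact θ.commutes (Ideal.Quotient.mk P a)

end Algebra

/-! ### Topology and characters of the dual group -/

section Dual

variable {M : Type*} [CommRing M] [TopologicalSpace M] [DiscreteTopology M]

theorem isInducing_dual_coe :
    IsInducing (fun (x : Dual M) (m : Multiplicative M) => x m) :=
  (ContinuousMap.homeoFnOfDiscrete (X := Multiplicative M) (Y := Circle)).isInducing.comp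
    (ContinuousMonoidHom.isInducing_toContinuousMap (Multiplicative M) Circle)

/-- Expansiveness of the dual action in terms of finitely many evaluations. -/
theorem isExpansive_dualAction_iff (G : Subgroup Mˣ) :
    IsExpansive (dualAction G) ↔ ∃ F : Finset M, ∃ U ∈ 𝓝 (1 : Circle), ∀ x : Dual M,
      (∀ g : G, ∀ m ∈ F, x (Multiplicative.ofAdd (((g : Mˣ) : M) * m)) ∈ U) → x = 1 := by
  classical
  constructor
  · rintro ⟨N, hN, hinter⟩
    rw [isInducing_dual_coe.nhds_eq_comap, Filter.mem_comap] at hN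
    obtain ⟨t, ht, htN⟩ := hN
    rw [nhds_pi, Filter.mem_pi] at ht
    obtain ⟨I, hI, u, hu, hIu⟩ := ht
    refine ⟨hI.toFinset.image Multiplicative.toAdd, ⋂ m ∈ I, u m,
      (Filter.biInter_mem hI).mpr fun m _ => hu m, fun x hx => ?_⟩
    have hmem : x ∈ ⋂ g, (dualAction G g : Dual M → Dual M) '' N := by
      refine Set.mem_iInter.mpr fun g => ⟨dualAut ((g : Mˣ)⁻¹) x, htN (hIu fun m hm => ?_), ?_⟩
      · exact Set.mem_iInter₂.mp
          (hx g⁻¹ m.toAdd (Finset.mem_image_of_mem _ (hI.mem_toFinset.mpr hm))) m hm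
      · change dualAut (g : Mˣ) (dualAut ((g : Mˣ)⁻¹) x) = x
        rw [← dualAut_mul, mul_inv_cancel, dualAut_one]
    rw [hinter] at hmem
    exact hmem
  · rintro ⟨F, U, hU, h⟩
    refine ⟨⋂ m ∈ F, {x : Dual M | x (Multiplicative.ofAdd m) ∈ U},
      (Filter.biInter_finset_mem F).mpr fun m _ => ?_, Set.Subset.antisymm ?_ ?_⟩
    · have hc : Continuous fun x : Dual M => x (Multiplicative.ofAdd m) :=
        (continuous_apply _).comp isInducing_dual_coe.continuous
      exact hc.continuousAt.preimage_mem_nhds hU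
    · intro x hx
      refine h x fun g m hm => ?_
      obtain ⟨z, hz, hzx⟩ := Set.mem_iInter.mp hx g⁻¹
      have hz' : dualAut (g : Mˣ) x = z := by
        rw [← hzx]
        change dualAut (g : Mˣ) (dualAut ((g : Mˣ)⁻¹) z) = z
        rw [← dualAut_mul, mul_inv_cancel, dualAut_one]
      rw [← dualAut_apply, hz']
      exact Set.mem_iInter₂.mp hz m hm
    · rintro _ rfl
      exact Set.mem_iInter.mpr fun g => ⟨1,
        Set.mem_iInter₂.mpr fun m _ => (mem_of_mem_nhds hU : (1 : Circle) ∈ U),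
        map_one (dualAction G g)⟩

/-- The element of the dual given by an additive character. -/
noncomputable def dualOfHom (f : M →+ Additive Circle) : Dual M :=
  ({ toMonoidHom := AddMonoidHom.toMultiplicativeLeft f
     continuous_toFun := continuous_of_discreteTopology } : Multiplicative M →ₜ* Circle)

theorem dualOfHom_apply (f : M →+ Additive Circle) (m : M) :
    dualOfHom f (Multiplicative.ofAdd m) = (f m).toMul := rfl

/-- The embedding of `ℚ / ℤ` into the circle. -/
noncomputable def ratCircleHom : AddCircle (1 : ℚ) →+ Additive Circle :=
  QuotientAddGroup.lift _
    { toFun := fun q : ℚ => Additive.ofMul (Circle.exp ((q : ℝ) * (2 * Real.pi)))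
      map_zero' := by simp
      map_add' := fun a b => by
        rw [Rat.cast_add, add_mul, Circle.exp_add, ofMul_mul] } (by
    intro q hq
    obtain ⟨n, rfl⟩ := AddSubgroup.mem_zmultiples_iff.mp hq
    exact congrArg Additive.ofMul (Circle.exp_eq_one.mpr ⟨n, by simp⟩))

theorem ratCircleHom_ne_zero {c : AddCircle (1 : ℚ)} (hc : c ≠ 0) : ratCircleHom c ≠ 0 := by
  obtain ⟨q, rfl⟩ := QuotientAddGroup.mk_surjective c
  intro h
  refine hc ?_
  obtain ⟨n, hn⟩ := Circle.exp_eq_one.mp (congrArg Additive.toMul h :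
    Circle.exp ((q : ℝ) * (2 * Real.pi)) = 1)
  have hq : (q : ℝ) = n := mul_right_cancel₀ Real.two_pi_pos.ne' hn
  refine (QuotientAddGroup.eq_zero_iff q).mpr (AddSubgroup.mem_zmultiples_iff.mpr ⟨n, ?_⟩)
  rw [zsmul_one]
  exact_mod_cast hq.symm

/-- Elements of the dual separate points from subgroups. -/
theorem exists_dual_ne_one (H : AddSubgroup M) {m : M} (hm : m ∉ H) :
    ∃ x : Dual M, (∀ h ∈ H, x (Multiplicative.ofAdd h) = 1) ∧ x ≠ 1 := by
  obtain ⟨c, hc⟩ := CharacterModule.exists_character_apply_ne_zero_of_ne_zero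
    (a := (QuotientAddGroup.mk m : M ⧸ H)) (fun h => hm ((QuotientAddGroup.eq_zero_iff m).mp h))
  let c' : M ⧸ H →+ AddCircle (1 : ℚ) := c
  let x := dualOfHom ((ratCircleHom.comp c').comp (QuotientAddGroup.mk' H))
  refine ⟨x, fun h hh => ?_, fun hx => ratCircleHom_ne_zero hc ?_⟩
  · change (ratCircleHom (c' (h : M ⧸ H))).toMul = 1
    rw [(QuotientAddGroup.eq_zero_iff h).mpr hh, map_zero, map_zero, toMul_zero]
  · exact congrArg (fun z : Dual M => Additive.ofMul (z (Multiplicative.ofAdd m))) hx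

end Dual

/-! ### The group ring, `M_G`, and integrality through valuation rings -/

section Main

variable {M : Type*} [CommRing M]

theorem groupRingHom_single (G : Subgroup Mˣ) (g : G) (n : ℤ) :
    groupRingHom G (MonoidAlgebra.single g n) = n • ((g : Mˣ) : M) :=
  MonoidAlgebra.lift_single _ _ _

theorem groupRingHom_apply (G : Subgroup Mˣ) (f : MonoidAlgebra ℤ G) :
    groupRingHom G f = f.coeff.sum fun g n => n • ((g : Mˣ) : M) :=
  MonoidAlgebra.lift_apply _ _

theorem range_groupRingHom (G : Subgroup Mˣ) : (groupRingHom G).range = unitSubring G := by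
  apply le_antisymm
  · rintro _ ⟨f, rfl⟩
    rw [groupRingHom_apply]
    exact sum_mem fun g _ => zsmul_mem (toUnitSubring G g).2 _
  · refine Subring.closure_le.mpr ?_
    rintro _ ⟨u, hu, rfl⟩
    exact ⟨MonoidAlgebra.single ⟨u, hu⟩ 1, by rw [groupRingHom_single, one_smul]⟩

/-- The natural homomorphism from the group ring onto `M_G`. -/
noncomputable def groupRingToUnitSubring (G : Subgroup Mˣ) : MonoidAlgebra ℤ G →+* unitSubring G :=
  (groupRingHom G).codRestrict (unitSubring G) fun f => by
    rw [← range_groupRingHom]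
    exact ⟨f, rfl⟩

theorem groupRingToUnitSubring_surjective (G : Subgroup Mˣ) :
    Function.Surjective (groupRingToUnitSubring G) := by
  rintro ⟨a, ha⟩
  rw [← range_groupRingHom] at ha
  obtain ⟨f, rfl⟩ := ha
  exact ⟨f, rfl⟩

theorem groupRingToUnitSubring_single (G : Subgroup Mˣ) (g : G) :
    groupRingToUnitSubring G (MonoidAlgebra.single g 1) = toUnitSubring G g :=
  Subtype.ext ((groupRingHom_single G g 1).trans (one_smul _ _))

theorem toUnitSubring_isUnit (G : Subgroup Mˣ) (g : G) : IsUnit (toUnitSubring G g) :=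
  IsUnit.of_mul_eq_one (toUnitSubring G g⁻¹) (Subtype.ext (Units.mul_inv (g : Mˣ)))

theorem logMap_toUnitSubring_eq_zero_iff (G : Subgroup Mˣ) (φ : unitSubring G →+* ℂ) (g : G) :
    logMap φ (toUnitSubring G g) = 0 ↔ ‖φ (toUnitSubring G g)‖ = 1 := by
  have h0 : φ (toUnitSubring G g) ≠ 0 := ((toUnitSubring_isUnit G g).map φ).ne_zero
  -- `Real.log` also vanishes at `0` and `-1`; positivity of the norm excludes both.
  rw [logMap, if_neg h0, WithTop.coe_eq_zero, Real.log_eq_zero]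
  have := norm_pos_iff.mpr h0
  constructor
  · rintro (h | h | h) <;> linarith
  · exact fun h => Or.inr (Or.inl h)

/-- The valuations trivial on `G` all have valuation rings containing `M` if and only if `M` is
integral over the group ring. -/
theorem zarDiff_nontrivial_iff [IsDomain M] {k : Type*} [Field k] [Algebra M k]
    [IsFractionRing M k] (G : Subgroup Mˣ) :
    (∀ V ∈ zarDiff M k, ∃ g : G, V.valuation (algebraMap M k ((g : Mˣ) : M)) ≠ 1) ↔
      (groupRingHom G).IsIntegral := by
  have hinj : Function.Injective (algebraMap M k) := IsFractionRing.injective M k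
  let s : Set k := Set.range fun g : G => algebraMap M k ((g : Mˣ) : M)
  have htriv : ∀ V : ValuationSubring k,
      (∀ g : G, V.valuation (algebraMap M k ((g : Mˣ) : M)) = 1) ↔ s ⊆ V.toSubring := by
    intro V
    constructor
    · rintro h _ ⟨g, rfl⟩
      exact (V.valuation_le_one_iff _).mp (h g).le
    · intro h g
      have h1 : ∀ g : G, V.valuation (algebraMap M k ((g : Mˣ) : M)) ≤ 1 := fun g =>
        (V.valuation_le_one_iff _).mpr (h ⟨g, rfl⟩)
      refine le_antisymm (h1 g) ?_
      -- `G` is closed under inverses, so values at most `1` on `G` must equal `1`.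
      have h2 : V.valuation (algebraMap M k ((g : Mˣ) : M)) *
          V.valuation (algebraMap M k (((g⁻¹ : G) : Mˣ) : M)) = 1 := by
        rw [← map_mul, ← map_mul]
        simp
      rw [← h2]
      exact mul_le_of_le_one_right' (h1 g⁻¹)
  have hclosure : Subring.closure s = ((algebraMap M k).comp (groupRingHom G)).range := by
    rw [← RingHom.map_range, range_groupRingHom, unitSubring, RingHom.map_closure]
    congr 1
    ext a
    simp [s]
  have hint : ∀ m : M, algebraMap M k m ∈ integralClosure (Subring.closure s) k ↔
      (groupRingHom G).IsIntegralElem m := by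
    intro m
    rw [hclosure]
    constructor
    · rintro ⟨p, hp, hpm⟩
      have hlift : p ∈ Polynomial.lifts
          ((algebraMap M k).comp (groupRingHom G)).rangeRestrict := by
        rw [Polynomial.mem_lifts]
        exact Polynomial.map_surjective _ (RingHom.rangeRestrict_surjective _) p
      obtain ⟨q, hq, -, hqm⟩ := Polynomial.lifts_and_natDegree_eq_and_monic hlift hp
      refine ⟨q, hqm, hinj ?_⟩
      rw [Polynomial.hom_eval₂, map_zero, ← hpm, ← hq, Polynomial.eval₂_map]
      rfl
    · rintro ⟨q, hqm, hq⟩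
      refine ⟨q.map ((algebraMap M k).comp (groupRingHom G)).rangeRestrict, hqm.map _, ?_⟩
      rw [Polynomial.eval₂_map, ← map_zero (algebraMap M k), ← hq, Polynomial.hom_eval₂]
      rfl
  calc _ ↔ ∀ m : M, algebraMap M k m ∈
        (⨅ V : {V : ValuationSubring k // s ⊆ V.toSubring}, V.1.toSubring) := by
        constructor
        · intro h m
          refine Subring.mem_iInf.mpr fun V => ?_
          by_contra hm
          obtain ⟨g, hg⟩ := h V.1 ⟨(bot_le : ⊥ ≤ V.1.toSubring), fun hle => hm (hle ⟨m, rfl⟩)⟩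
          exact hg ((htriv V.1).mpr V.2 g)
        · intro h V hV
          by_contra! hcon
          refine hV.2 ?_
          rintro _ ⟨m, rfl⟩
          exact Subring.mem_iInf.mp (h m) ⟨V, (htriv V).mp hcon⟩
    _ ↔ (groupRingHom G).IsIntegral := by
        rw [iInf_valuationSubring_superset]
        exact forall_congr' hint

end Main

/-! ### The two directions of the criterion -/

section Expansive

variable {M : Type*} [CommRing M] [TopologicalSpace M] {G : Subgroup Mˣ}

/-- A real lift of a circle-valued solution of a linear recurrence is itself a solution if it is
uniformly small. -/
theorem sum_arg_eq_zero {x : Dual M} {δ : ℝ} {m : M}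
    (hx : ∀ g : G, |Complex.arg (x (Multiplicative.ofAdd (((g : Mˣ) : M) * m)))| ≤ δ)
    {f : MonoidAlgebra ℤ G} (hf : groupRingHom G f = 0)
    (hδ : δ * ∑ g ∈ f.coeff.support, |(f.coeff g : ℝ)| < 2 * Real.pi) (h : G) :
    (f.coeff.sum fun g n =>
      n • Complex.arg (x (Multiplicative.ofAdd (((h * g : G) : Mˣ) * m)))) = 0 := by
  set r : ℝ := f.coeff.sum fun g n =>
      n • Complex.arg (x (Multiplicative.ofAdd (((h * g : G) : Mˣ) * m))) with hr
  have habs : |r| < 2 * Real.pi := by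
    refine lt_of_le_of_lt ?_ hδ
    rw [hr, Finsupp.sum, Finset.mul_sum]
    refine (Finset.abs_sum_le_sum_abs _ _).trans (Finset.sum_le_sum fun g _ => ?_)
    rw [zsmul_eq_mul, abs_mul, mul_comm]
    gcongr
    exact hx (h * g)
  -- The exponential of `r` is `x` evaluated at `h * f * m = 0`; hence `r` is a multiple of `2π`,
  -- and smallness makes it `0`.
  have hexp : Circle.exp r = 1 := by
    let E : ℝ →+ Additive Circle := Circle.expHom
    let X : M →+ Additive Circle := AddMonoidHom.toMultiplicativeLeft.symm
      (x : Multiplicative M →* Circle)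
    have hEX : ∀ a : M, E (Complex.arg (x (Multiplicative.ofAdd a))) = X a := fun a =>
      congrArg Additive.ofMul (Circle.exp_arg _)
    change E r = 0
    have hsum : (f.coeff.sum fun g n => n • ((((h * g : G) : Mˣ) : M) * m)) = 0 := by
      have : ((h : Mˣ) : M) * groupRingHom G f * m = 0 := by rw [hf, mul_zero, zero_mul]
      rw [← this, groupRingHom_apply, Finsupp.mul_sum, Finsupp.sum_mul]
      refine Finset.sum_congr rfl fun g _ => ?_
      push_cast
      simp only [zsmul_eq_mul]
      ring
    rw [hr, Finsupp.sum, map_sum, ← map_zero X, ← hsum, Finsupp.sum, map_sum]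
    refine Finset.sum_congr rfl fun g _ => ?_
    rw [map_zsmul, map_zsmul, hEX]
  obtain ⟨n, hn⟩ := Circle.exp_eq_one.mp hexp
  rw [hn, abs_mul, abs_of_pos Real.two_pi_pos] at habs
  have hn1 : |(n : ℝ)| < 1 := by
    by_contra! hle
    nlinarith [Real.two_pi_pos]
  have hn0 : n = 0 := by
    rw [← Int.abs_lt_one_iff]
    exact_mod_cast hn1
  rw [hn, hn0, Int.cast_zero, zero_mul]

variable [DiscreteTopology M]

/-- The finite set testing expansiveness generates `M`: otherwise a nontrivial character of the
quotient by its `G`-stable span is `1` on every test. -/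
theorem IsExpansive.groupRingHom_finite (h : IsExpansive (dualAction G)) :
    (groupRingHom G).Finite := by
  obtain ⟨F, U, hU, hFU⟩ := (isExpansive_dualAction_iff G).mp h
  let := (groupRingHom G).toAlgebra
  refine ⟨⟨F, ?_⟩⟩
  by_contra hspan
  obtain ⟨m, hm⟩ : ∃ m, m ∉ Submodule.span (MonoidAlgebra ℤ G) (F : Set M) := by
    by_contra! hall
    exact hspan (eq_top_iff.mpr fun m _ => hall m)
  obtain ⟨x, hx, hx1⟩ := exists_dual_ne_one
    (Submodule.span (MonoidAlgebra ℤ G) (F : Set M)).toAddSubgroup hm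
  refine hx1 (hFU x fun g m hm => ?_)
  rw [hx]
  · exact mem_of_mem_nhds hU
  · have hsmul : (MonoidAlgebra.single g 1 : MonoidAlgebra ℤ G) • m = ((g : Mˣ) : M) * m := by
      rw [Algebra.smul_def, RingHom.algebraMap_toAlgebra, groupRingHom_single, one_smul]
    exact hsmul ▸ Submodule.smul_mem _ _ (Submodule.subset_span hm)

theorem IsExpansive.exists_norm_ne_one (h : IsExpansive (dualAction G))
    (φ : unitSubring G →+* ℂ) : ∃ g : G, ‖φ (toUnitSubring G g)‖ ≠ 1 := by
  by_contra! hφ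
  obtain ⟨θ, hθ⟩ := exists_comp_eq_of_isIntegral (groupRingHom G)
    h.groupRingHom_finite.to_isIntegral (φ.comp (groupRingToUnitSubring G)) fun f hf => by
      have : groupRingToUnitSubring G f = 0 := Subtype.ext hf
      rw [RingHom.mem_ker, RingHom.comp_apply, this, map_zero]
  have hθg : ∀ g : G, ‖θ ((g : Mˣ) : M)‖ = 1 := by
    intro g
    have h1 := RingHom.congr_fun hθ (MonoidAlgebra.single g 1)
    rw [RingHom.comp_apply, RingHom.comp_apply, groupRingHom_single, one_smul,
      groupRingToUnitSubring_single] at h1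
    rw [h1, hφ]
  obtain ⟨F, U, hU, hFU⟩ := (isExpansive_dualAction_iff G).mp h
  have hexp : ∀ᶠ r : ℝ in 𝓝 0, Circle.exp r ∈ U :=
    Circle.exp.continuous.continuousAt.preimage_mem_nhds (by rwa [Circle.exp_zero])
  obtain ⟨δ, hδ, hδU⟩ := Metric.eventually_nhds_iff.mp hexp
  -- The bound `t ≤ 1 < π` later recovers `t` as the argument of `exp(i t)`, the value of `x` at
  -- `1`.
  obtain ⟨t, ht0, ht1, htF⟩ : ∃ t : ℝ, 0 < t ∧ t ≤ 1 ∧ ∀ m ∈ F, t * ‖θ m‖ < δ := by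
    have hs : 0 < 1 + ∑ m ∈ F, ‖θ m‖ := by positivity
    refine ⟨min 1 (δ / (1 + ∑ m ∈ F, ‖θ m‖)), by positivity, min_le_left _ _, fun m hm => ?_⟩
    have hle : ‖θ m‖ < 1 + ∑ m ∈ F, ‖θ m‖ := by
      linarith [Finset.single_le_sum (fun i _ => norm_nonneg (θ i)) hm]
    calc _ ≤ δ / (1 + ∑ m ∈ F, ‖θ m‖) * ‖θ m‖ := by gcongr; exact min_le_right _ _
      _ < δ / (1 + ∑ m ∈ F, ‖θ m‖) * (1 + ∑ m ∈ F, ‖θ m‖) := by gcongr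
      _ = δ := div_mul_cancel₀ _ hs.ne'
  let x : Dual M := dualOfHom
    { toFun := fun m => Additive.ofMul (Circle.exp (t * (θ m).re))
      map_zero' := by simp
      map_add' := fun a b => by
        rw [map_add, Complex.add_re, mul_add, Circle.exp_add, ofMul_mul] }
  have hx : x = 1 := hFU x fun g m hm => by
    refine hδU ?_
    rw [dist_zero_right, Real.norm_eq_abs, abs_mul, abs_of_pos ht0]
    refine lt_of_le_of_lt ?_ (htF m hm)
    gcongr
    refine (Complex.abs_re_le_norm _).trans ?_
    change ‖θ (((g : Mˣ) : M) * m)‖ ≤ ‖θ m‖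
    rw [map_mul, norm_mul, hθg, one_mul]
  have hone : Circle.exp (t * (θ 1).re) = 1 :=
    congrArg (fun z : Dual M => z (Multiplicative.ofAdd 1)) hx
  rw [map_one, Complex.one_re, mul_one, ← Circle.arg_eq_zero,
    Circle.arg_exp (by linarith [Real.pi_gt_three]) (by linarith [Real.pi_gt_three])] at hone
  exact ht0.ne' hone

/-- Small orbits on module generators are trivial there, because their arguments solve recurrences
with no nonzero bounded solution; generation then gives `x = 1`. -/
theorem isExpansive_of_finite (hfin : (groupRingHom G).Finite)
    (hφ : ∀ φ : unitSubring G →+* ℂ, ∃ g : G, ‖φ (toUnitSubring G g)‖ ≠ 1) :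
    IsExpansive (dualAction G) := by
  have hno : ¬ ∃ χ : G →* ℂ, (∀ g, ‖χ g‖ = 1) ∧
      ∀ f ∈ (RingHom.ker (groupRingHom G) : Set (MonoidAlgebra ℤ G)),
        MonoidAlgebra.lift ℤ _ G χ f = 0 := by
    rintro ⟨χ, hχ, hker⟩
    let φ : unitSubring G →+* ℂ := RingHom.liftOfSurjective (groupRingToUnitSubring G)
      (groupRingToUnitSubring_surjective G)
      ⟨(MonoidAlgebra.lift ℤ ℂ G χ : MonoidAlgebra ℤ G →+* ℂ),
        fun f hf => hker f (congrArg Subtype.val hf)⟩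
    obtain ⟨g, hg⟩ := hφ φ
    refine hg ?_
    rw [← groupRingToUnitSubring_single, RingHom.liftOfRightInverse_comp_apply]
    change ‖MonoidAlgebra.lift ℤ ℂ G χ (MonoidAlgebra.single g 1)‖ = 1
    rw [MonoidAlgebra.lift_single, one_smul, hχ]
  obtain ⟨T, hTker, hT⟩ := exists_finite_of_no_character hno
  let := (groupRingHom G).toAlgebra
  obtain ⟨F, hF⟩ : ∃ F : Finset M, Submodule.span (MonoidAlgebra ℤ G) (F : Set M) = ⊤ :=
    hfin.fg_top
  obtain ⟨δ, hδ0, hδ⟩ : ∃ δ : ℝ, 0 < δ ∧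
      ∀ f ∈ T, δ * ∑ g ∈ f.coeff.support, |(f.coeff g : ℝ)| < 2 * Real.pi := by
    let N : MonoidAlgebra ℤ G → ℝ := fun f => ∑ g ∈ f.coeff.support, |(f.coeff g : ℝ)|
    have hN : ∀ f, 0 ≤ N f := fun f => Finset.sum_nonneg fun _ _ => abs_nonneg _
    have hs : 0 < 1 + ∑ f ∈ T, N f := by linarith [Finset.sum_nonneg fun f (_ : f ∈ T) => hN f]
    -- This makes `δ * N f ≤ 1 < 2π`; the summand `1` keeps the denominator positive.
    refine ⟨1 / (1 + ∑ f ∈ T, N f), by positivity, fun f hf => ?_⟩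
    have hle : N f ≤ 1 + ∑ f ∈ T, N f := by
      linarith [Finset.single_le_sum (fun i _ => hN i) hf]
    change 1 / (1 + ∑ f ∈ T, N f) * N f < 2 * Real.pi
    rw [one_div_mul_eq_div]
    linarith [(div_le_one hs).mpr hle, Real.pi_gt_three]
  have hU : {z : Circle | |Complex.arg z| ≤ δ} ∈ 𝓝 (1 : Circle) := by
    have hc : ContinuousAt (fun z : Circle => |Complex.arg (z : ℂ)|) 1 :=
      ((Complex.continuousAt_arg (by simp)).comp continuous_subtype_val.continuousAt).abs
    exact hc.eventually_le_const (by simpa using hδ0)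
  refine (isExpansive_dualAction_iff G).mpr ⟨F, _, hU, fun x hx => ?_⟩
  have hone : ∀ m ∈ F, ∀ g : G, x (Multiplicative.ofAdd (((g : Mˣ) : M) * m)) = 1 := by
    intro m hm
    by_contra hne
    let y : G → ℂ := fun g => (Complex.arg (x (Multiplicative.ofAdd (((g : Mˣ) : M) * m))) : ℂ)
    have hy : y ≠ 0 := fun h0 => hne fun g => by
      have := congrFun h0 g
      rw [Pi.zero_apply, Complex.ofReal_eq_zero] at this
      exact Circle.arg_eq_zero.mp this
    refine hT (exists_character_of_bounded (S := (T : Set (MonoidAlgebra ℤ G))) (y := y)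
      (C := δ) (fun g => ?_) hy fun f hf h => ?_)
    · rw [Complex.norm_real]
      exact hx g m hm
    · have hsum := sum_arg_eq_zero (fun g => hx g m hm) (hTker hf) (hδ f hf) h
      have := congrArg (Complex.ofReal) hsum
      rw [Finsupp.sum, Complex.ofReal_sum, Complex.ofReal_zero] at this
      rw [← this]
      refine Finset.sum_congr rfl fun g _ => ?_
      simp [y]
  refine PontryaginDual.ext fun a => ?_
  let X : M →+ Additive Circle := AddMonoidHom.toMultiplicativeLeft.symm
    (x : Multiplicative M →* Circle)
  have hX : ∀ b ∈ Submodule.span (MonoidAlgebra ℤ G) (F : Set M), X b = 0 := by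
    intro b hb
    induction hb using Submodule.closure_induction with
    | zero => exact map_zero X
    | add b c _ _ hb hc => rw [map_add, hb, hc, add_zero]
    | smul_mem f m hm =>
      rw [Algebra.smul_def, RingHom.algebraMap_toAlgebra, groupRingHom_apply, Finsupp.sum_mul,
        Finsupp.sum, map_sum]
      refine Finset.sum_eq_zero fun g _ => ?_
      rw [smul_mul_assoc, map_zsmul, show X (((g : Mˣ) : M) * m) = 0 from hone m hm g, smul_zero]
  exact hX a.toAdd (hF ▸ trivial)

end Expansive

end AlgebraicAction

theorem mainTheorem2 {M : Type*} [CommRing M] [IsDomain M]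
    [TopologicalSpace M] [DiscreteTopology M]
    {k : Type*} [Field k] [Algebra M k] [IsFractionRing M k]
    (G : Subgroup Mˣ) (hfin : (AlgebraicAction.groupRingHom G).FiniteType) :
    AlgebraicAction.IsExpansive (AlgebraicAction.dualAction G) ↔
      (∀ v ∈ AlgebraicAction.logMaps (AlgebraicAction.unitSubring G),
          ∃ g : G, v (AlgebraicAction.toUnitSubring G g) ≠ 0) ∧
        (∀ V ∈ AlgebraicAction.zarDiff M k,
          ∃ g : G, V.valuation (algebraMap M k ((g : Mˣ) : M)) ≠ 1) := by
  rw [AlgebraicAction.zarDiff_nontrivial_iff, AlgebraicAction.logMaps, Set.forall_mem_range]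
  simp only [ne_eq, AlgebraicAction.logMap_toUnitSubring_eq_zero_iff]
  exact ⟨fun h => ⟨h.exists_norm_ne_one, h.groupRingHom_finite.to_isIntegral⟩,
    -- Integral and of finite type together give module-finite.
    fun h => AlgebraicAction.isExpansive_of_finite (h.2.to_finite hfin) h.1⟩
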